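/- All graphs are finite and simple. For a connected graph $G$ and a vertex $u$ let $e(u)=\max_{v}d(u,v)$ be its eccentricity, put $f(x,y)=\sqrt{\frac{x+y-2}{xy}}$, and let $ABC_3(G)=\sum_{uv\in E(G)}f(e(u),e(v))$. A graph is unicyclic if it is connected and contains exactly one cycle. For $k\ge 3$ and integers $n_1,\dots,n_k\ge 0$ with $n_1+\dots+n_k=n-k$, let $H(n,k;n_1,\dots,n_k)$ be the graph of order $n$ obtained from a cycle $v_1v_2\cdots v_k$ by attaching $n_i$ new pendant vertices to $v_i$ for every $i$. Lemma 2.5. Let $G$ be a unicyclic graph of order $n\ge 6$ and girth $k$ with $3\le k\le n-1$ (that is, $G$ is not a cycle). (a) If $k=3$, then $ABC_3(G)\le n\sqrt{\tfrac12}$, with equality if and only if $G\cong H(n,3;n_1,n_2,n_3)$ for some $n_1,n_2,n_3\ge 0$ with $n_1+n_2+n_3=n-3$. (b) If $k\ge 4$ is even, then $$ABC_3(G)\le (n-k+2)\,f\!\left(\tfrac k2+1,\tfrac k2\right)+(k-2)\,f\!\left(\tfrac k2,\tfrac k2\right),$$ with equality if and only if $G\cong H(n,k;n-k,0,\dots,0)$.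 (c) If $k\ge 5$ is odd, then $$ABC_3(G)\le (n-k+2)\,f\!\left(\tfrac{k+1}2,\tfrac{k-1}2\right)+(k-3)\,f\!\left(\tfrac{k-1}2,\tfrac{k-1}2\right)+f\!\left(\tfrac{k+1}2,\tfrac{k+1}2\right),$$ with equality if and only if $G\cong H(n,k;n-k,0,\dots,0)$. -/

import Mathlib

namespace ABCThree

/-- A unicyclic graph: a connected graph containing exactly one cycle. Cycles are identified with
their edge sets, so that the choice of base point and of orientation does not matter. -/
def IsUnicyclic {V : Type*} (G : SimpleGraph V) : Prop :=
  G.Connected ∧ ∃! s : Set (Sym2 V), ∃ (v : V) (p : G.Walk v v), p.IsCycle ∧ p.edgeSet = s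

/-- `f x y = √((x + y - 2) / (x y))`. -/
noncomputable def f (x y : ℝ) : ℝ := Real.sqrt ((x + y - 2) / (x * y))

theorem f_comm (x y : ℝ) : f x y = f y x := by
  unfold f
  rw [add_comm x y, mul_comm x y]

/-- The eccentricity of a vertex of a finite connected graph, as a natural number. -/
noncomputable def ecc {V : Type*} (G : SimpleGraph V) (u : V) : ℕ := (G.eccent u).toNat

/-- The contribution of an edge `uv` to the third atom-bond connectivity index. -/
noncomputable def edgeTerm {V : Type*} (G : SimpleGraph V) : Sym2 V → ℝ :=
  Sym2.lift ⟨fun u v => f (ecc G u) (ecc G v), fun _ _ => f_comm _ _⟩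

open Classical in
/-- The third atom-bond connectivity index: the sum over all edges `uv` of
`√((e(u) + e(v) - 2) / (e(u) e(v)))`. -/
noncomputable def ABC3 {V : Type*} [Fintype V] (G : SimpleGraph V) : ℝ :=
  ∑ e ∈ G.edgeFinset, edgeTerm G e

/-- The cycle on `k` vertices with `m i` new pendant vertices attached to its `i`-th vertex.
The vertex `Sum.inl i` is the `i`-th vertex of the cycle and `Sum.inr ⟨i, j⟩` is the `j`-th of
the new vertices attached to it. -/
def H (k : ℕ) (m : Fin k → ℕ) : SimpleGraph (Fin k ⊕ (Σ i : Fin k, Fin (m i))) where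
  Adj
    | .inl i, .inl j => (SimpleGraph.cycleGraph k).Adj i j
    | .inl i, .inr x => x.1 = i
    | .inr x, .inl i => x.1 = i
    | .inr _, .inr _ => False
  symm := by
    constructor
    rintro (i | x) (j | y) h
    · exact SimpleGraph.Adj.symm h
    · exact h
    · exact h
    · exact h
  loopless := by
    constructor
    rintro (i | x) h
    · exact SimpleGraph.irrefl _ h
    · exact h

/-- The sequence `(a, 0, …, 0)` of length `k`. -/
def allAtFirst (k a : ℕ) : Fin k → ℕ := fun i => if (i : ℕ) = 0 then a else 0

end ABCThree

/-!
A unicyclic graph is a cycle `v_0, …, v_{k-1}` with a rooted tree attached to each of its vertices.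
A vertex at height `h` in its tree has eccentricity at least `h + ⌊k / 2⌋`, because the cycle has a
vertex antipodal to its root. If the tree at `v_0` is nontrivial, then also
`e(v_i) ≥ 1 + d(v_0, v_i)`. Since `f` is antitone in both arguments on `[2, ∞)`, this bounds the
contribution of every edge by the one it has in `H(n, k; n - k, 0, …, 0)`. If equality holds, then
all trees have height at most one; a second nontrivial tree, at `v_j`, would make the eccentricity
of `v_0`, or of a vertex antipodal to `v_j`, too large.

For `k = 3` the vertices of the cycle may have eccentricity 1, but `f(1, 2) = f(2, y) = √(1/2)` for
all `y`, whereas `f(x, y) < √(1/2)` for `x, y > 2`. So equality means that every edge has an end of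
eccentricity at most two, which fails on the cycle once some vertex has height at least two.
-/

namespace ABCThree

open SimpleGraph

/-! ### The weight function -/

theorem f_le_f_left {x x' y : ℝ} (hx : 0 < x) (hxx' : x ≤ x') (hy : 2 ≤ y) :
    f x' y ≤ f x y := by
  have hx' : 0 < x' := hx.trans_le hxx'
  have hy0 : 0 < y := by linarith
  refine Real.sqrt_le_sqrt ?_
  rw [div_le_div_iff₀ (by positivity) (by positivity)]
  have hdiff : 0 ≤ y * ((x' - x) * (y - 2)) :=
    mul_nonneg hy0.le (mul_nonneg (sub_nonneg.2 hxx') (sub_nonneg.2 hy))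
  linarith

theorem f_lt_f_left {x x' y : ℝ} (hx : 0 < x) (hxx' : x < x') (hy : 2 < y) :
    f x' y < f x y := by
  have hx' : 0 < x' := hx.trans hxx'
  have hy0 : 0 < y := by linarith
  refine Real.sqrt_lt_sqrt (div_nonneg (by linarith) (by positivity)) ?_
  rw [div_lt_div_iff₀ (by positivity) (by positivity)]
  have hdiff : 0 < y * ((x' - x) * (y - 2)) :=
    mul_pos hy0 (mul_pos (sub_pos.2 hxx') (sub_pos.2 hy))
  linarith

theorem f_le_f {x x' y y' : ℝ} (hx : 2 ≤ x) (hxx' : x ≤ x') (hy : 2 ≤ y) (hyy' : y ≤ y') :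
    f x' y' ≤ f x y :=
  calc f x' y' ≤ f x y' := f_le_f_left (by linarith) hxx' (hy.trans hyy')
    _ = f y' x := f_comm _ _
    _ ≤ f y x := f_le_f_left (by linarith) hyy' hx
    _ = f x y := f_comm _ _

theorem f_lt_f {x x' y y' : ℝ} (hx : 2 ≤ x) (hxx' : x < x') (hy : 2 ≤ y) (hyy' : y ≤ y')
    (hy' : 2 < y') : f x' y' < f x y :=
  (f_lt_f_left (by linarith) hxx' hy').trans_le (f_le_f hx le_rfl hy hyy')

theorem f_two_left {y : ℝ} (hy : 0 < y) : f 2 y = √(1 / 2) := by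
  unfold f
  congr 1
  field_simp
  ring

theorem f_lt_sqrt_half {x y : ℝ} (hx : 2 < x) (hy : 2 < y) : f x y < √(1 / 2) :=
  (f_lt_f_left two_pos hx hy).trans_eq (f_two_left (by linarith))

theorem f_eq_sqrt_half_of_le_two {x y : ℕ} (hx : x ≤ 2) (hyx : y ≤ x + 1) (hxy : 3 ≤ x + y) :
    f x y = √(1 / 2) := by
  obtain ⟨rfl, rfl⟩ | rfl : (x = 1 ∧ y = 2) ∨ x = 2 := by omega
  · rw [f_comm]
    exact f_two_left (by norm_num)
  · exact f_two_left (by norm_cast; omega)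

theorem f_eq_sqrt_half_iff {x y : ℕ} (hxy : x ≤ y + 1) (hyx : y ≤ x + 1) (h3 : 3 ≤ x + y) :
    f x y = √(1 / 2) ↔ x ≤ 2 ∨ y ≤ 2 := by
  constructor
  · contrapose!
    exact fun ⟨hx, hy⟩ => (f_lt_sqrt_half (mod_cast hx) (mod_cast hy)).ne
  · rintro (hx | hy)
    · exact f_eq_sqrt_half_of_le_two hx hyx h3
    · rw [f_comm]
      exact f_eq_sqrt_half_of_le_two hy hxy (by omega)

theorem f_le_sqrt_half {x y : ℕ} (hxy : x ≤ y + 1) (hyx : y ≤ x + 1) (h3 : 3 ≤ x + y) :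
    f x y ≤ √(1 / 2) := by
  by_cases h2 : x ≤ 2 ∨ y ≤ 2
  · exact ((f_eq_sqrt_half_iff hxy hyx h3).2 h2).le
  · push Not at h2
    exact (f_lt_sqrt_half (mod_cast h2.1) (mod_cast h2.2)).le

/-! ### Distances and eccentricities -/

section Eccentricity

variable {V : Type*} {G : SimpleGraph V}

theorem edgeTerm_mk (u v : V) : edgeTerm G s(u, v) = f (ecc G u) (ecc G v) := rfl

theorem le_add_dist_of_adj (hG : G.Connected) {φ : V → ℕ}
    (hφ : ∀ u v, G.Adj u v → φ u ≤ φ v + 1) (u v : V) : φ u ≤ φ v + G.dist u v := by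
  obtain ⟨p, hp⟩ := hG.exists_walk_length_eq_dist u v
  rw [← hp]
  clear hp
  induction p with
  | nil => simp only [Walk.length_nil, add_zero, le_refl]
  | @cons u w v huw p ih =>
    calc φ u ≤ φ w + 1 := hφ u w huw
      _ ≤ φ v + p.length + 1 := by gcongr
      _ = φ v + (Walk.cons huw p).length := by rw [Walk.length_cons, add_assoc]

variable [Finite V]

theorem coe_ecc (hG : G.Connected) (u : V) : (ecc G u : ℕ∞) = G.eccent u := by
  obtain ⟨v, hv⟩ := G.exists_edist_eq_eccent_of_finite u
  exact ENat.natCast_toNat (hv ▸ edist_ne_top_iff_reachable.2 (hG.preconnected u v))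

theorem ecc_le_iff (hG : G.Connected) {u : V} {m : ℕ} : ecc G u ≤ m ↔ ∀ v, G.dist u v ≤ m := by
  rw [← Nat.cast_le (α := ℕ∞), coe_ecc hG, eccent_le_iff]
  refine forall_congr' fun v => ?_
  rw [← (hG.preconnected u v).coe_dist_eq_edist, Nat.cast_le]

theorem dist_le_ecc (hG : G.Connected) (u v : V) : G.dist u v ≤ ecc G u :=
  (ecc_le_iff hG).1 le_rfl v

theorem ecc_le_succ_of_adj (hG : G.Connected) {u v : V} (huv : G.Adj u v) :
    ecc G u ≤ ecc G v + 1 :=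
  (ecc_le_iff hG).2 fun w =>
    calc G.dist u w ≤ G.dist u v + G.dist v w := hG.dist_triangle
      _ ≤ 1 + ecc G v := add_le_add (dist_eq_one_iff_adj.2 huv).le (dist_le_ecc hG v w)
      _ = ecc G v + 1 := add_comm _ _

end Eccentricity

/-! ### Cycles with attached trees -/

/-- The distance between the `i`-th and the `j`-th vertex of a cycle of length `k`. The difference
`|i - j|` is written with truncated subtractions; index `k` is the same vertex as index `0`. -/
def cycleDist (k i j : ℕ) : ℕ := min ((i - j) + (j - i)) (k - ((i - j) + (j - i)))

/-- The eccentricity of the `i`-th vertex of the cycle of `H k (allAtFirst k a)` when `a ≠ 0`: the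
farthest vertex is either on the cycle or a pendant one. -/
def cycleEcc (k i : ℕ) : ℕ := max (k / 2) (cycleDist k 0 i + 1)

/-- A decomposition of a graph into a cycle of length `k` and trees attached to its vertices. The
cycle passes through `cycle 0, cycle 1, …, cycle k = cycle 0`, the vertex `v` lies in the tree
attached to `cycle (root v)`, and `height v` is its distance from `cycle (root v)`. The acyclicity
of the trees is not recorded, and `cycle i` with `i > k` is an unspecified vertex of height zero. -/
structure CycleTreeDecomp {V : Type*} (G : SimpleGraph V) (k : ℕ) where
  cycle : ℕ → V
  root : V → ℕ
  height : V → ℕ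
  three_le : 3 ≤ k
  cycle_length : cycle k = cycle 0
  adj_cycle : ∀ i < k, G.Adj (cycle i) (cycle (i + 1))
  root_lt : ∀ v, root v < k
  root_cycle : ∀ i < k, root (cycle i) = i
  height_cycle : ∀ i, height (cycle i) = 0
  cycle_root : ∀ v, height v = 0 → cycle (root v) = v
  adj_cases : ∀ u v, G.Adj u v → (∃ i < k, s(u, v) = s(cycle i, cycle (i + 1))) ∨
    (root u = root v ∧ (height u = height v + 1 ∨ height v = height u + 1))
  exists_parent : ∀ v, height v ≠ 0 →
    ∃ u, G.Adj v u ∧ root v = root u ∧ height v = height u + 1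

namespace CycleTreeDecomp

variable {V : Type*} {G : SimpleGraph V} {k : ℕ} (D : CycleTreeDecomp G k)

/-- A nontrivial tree is attached to the vertex `cycle 0`. -/
def HasTreeAtZero : Prop := ∃ v, D.height v ≠ 0 ∧ D.root v = 0

/-- All vertices off the cycle are pendant vertices attached to the cycle. -/
def IsSun : Prop := ∀ v, D.height v ≤ 1

/-- All vertices off the cycle are pendant vertices attached to the vertex `cycle 0`. -/
def PendantsAtZero : Prop := ∀ v, D.height v ≠ 0 → D.height v = 1 ∧ D.root v = 0

variable {D} in
theorem PendantsAtZero.isSun (hP : D.PendantsAtZero) : D.IsSun := fun v => by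
  by_contra hv
  exact hv (hP v (by omega)).1.le

theorem root_cycle_of_le {i : ℕ} (hi : i ≤ k) :
    (i < k ∧ D.root (D.cycle i) = i) ∨ (i = k ∧ D.root (D.cycle i) = 0) := by
  rcases hi.lt_or_eq with hi | rfl
  · exact .inl ⟨hi, D.root_cycle i hi⟩
  · refine .inr ⟨rfl, ?_⟩
    have := D.three_le
    rw [D.cycle_length, D.root_cycle 0 (by omega)]

theorem adj_cases_of_height_ne_zero {u v : V} (huv : G.Adj u v) (hu : D.height u ≠ 0) :
    D.root u = D.root v ∧ (D.height u = D.height v + 1 ∨ D.height v = D.height u + 1) := by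
  refine (D.adj_cases u v huv).resolve_left ?_
  rintro ⟨i, -, he⟩
  rcases Sym2.eq_iff.1 he with ⟨rfl, -⟩ | ⟨rfl, -⟩ <;> exact hu (D.height_cycle _)

variable {D} in
theorem IsSun.height_eq_zero_of_adj (hS : D.IsSun) {u w : V} (huw : G.Adj u w) :
    D.height u = 0 ∨ D.height w = 0 := by
  by_contra! h
  have := D.adj_cases_of_height_ne_zero huw h.1
  have := hS u
  have := hS w
  omega

theorem adj_cycle_root {v : V} (hv : D.height v = 1) : G.Adj v (D.cycle (D.root v)) := by
  obtain ⟨u, hvu, hroot, hheight⟩ := D.exists_parent v (by omega)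
  rwa [hroot, D.cycle_root u (by omega)]

theorem reachable_cycle_zero {i : ℕ} (hi : i ≤ k) : G.Reachable (D.cycle i) (D.cycle 0) := by
  induction i with
  | zero => rfl
  | succ i ih => exact (D.adj_cycle i hi).symm.reachable.trans (ih (Nat.le_of_succ_le hi))

theorem reachable_cycle_root (v : V) : G.Reachable v (D.cycle (D.root v)) := by
  induction hm : D.height v generalizing v with
  | zero => rw [D.cycle_root v hm]
  | succ m ih =>
    obtain ⟨u, hvu, hroot, hheight⟩ := D.exists_parent v (by omega)
    rw [hroot]
    exact hvu.reachable.trans (ih u (by omega))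

theorem connected (D : CycleTreeDecomp G k) : G.Connected := by
  have hzero (v : V) : G.Reachable v (D.cycle 0) :=
    (D.reachable_cycle_root v).trans (D.reachable_cycle_zero (D.root_lt v).le)
  exact (connected_iff G).2 ⟨fun u v => (hzero u).trans (hzero v).symm, ⟨D.cycle 0⟩⟩

/-! ### Distances in a cycle with attached trees -/

theorem height_add_cycleDist_le_dist (v : V) {j : ℕ} (hj : j ≤ k) :
    D.height v + cycleDist k (D.root v) j ≤ G.dist v (D.cycle j) := by
  have hstart : D.height (D.cycle j) + cycleDist k (D.root (D.cycle j)) j = 0 := by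
    rw [D.height_cycle]
    have := D.root_cycle_of_le hj
    unfold cycleDist
    omega
  have hstep (u w : V) (huw : G.Adj u w) : D.height u + cycleDist k (D.root u) j ≤
      D.height w + cycleDist k (D.root w) j + 1 := by
    rcases D.adj_cases u w huw with ⟨i, hi, he⟩ | ⟨hroot, hheight⟩
    · have hi₀ := D.root_cycle i hi
      have hi₁ := D.root_cycle_of_le (i := i + 1) hi
      rcases Sym2.eq_iff.1 he with ⟨rfl, rfl⟩ | ⟨rfl, rfl⟩ <;>
        · simp only [D.height_cycle, cycleDist]
          omega
    · rw [hroot]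
      omega
  have := le_add_dist_of_adj D.connected hstep v (D.cycle j)
  rwa [hstart, zero_add] at this

theorem dist_cycle_le_sub {i j : ℕ} (hij : i ≤ j) (hj : j ≤ k) :
    G.dist (D.cycle i) (D.cycle j) ≤ j - i := by
  induction j, hij using Nat.le_induction with
  | base => simp
  | succ j hij ih =>
    calc G.dist (D.cycle i) (D.cycle (j + 1))
        ≤ G.dist (D.cycle i) (D.cycle j) + G.dist (D.cycle j) (D.cycle (j + 1)) :=
          D.connected.dist_triangle
      _ ≤ (j - i) + 1 := add_le_add (ih (by omega)) (dist_eq_one_iff_adj.2 (D.adj_cycle j hj)).le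
      _ = j + 1 - i := by omega

theorem dist_cycle_le {i j : ℕ} (hi : i ≤ k) (hj : j ≤ k) :
    G.dist (D.cycle i) (D.cycle j) ≤ cycleDist k i j := by
  wlog hij : i ≤ j generalizing i j
  · rw [dist_comm]
    exact (this hj hi (by omega)).trans (by unfold cycleDist; omega)
  have hdirect := D.dist_cycle_le_sub hij hj
  have hzero_i := D.dist_cycle_le_sub (Nat.zero_le i) hi
  have hj_zero := D.dist_cycle_le_sub hj le_rfl
  have hround := D.connected.dist_triangle (u := D.cycle i) (v := D.cycle 0) (w := D.cycle j)
  rw [dist_comm] at hzero_i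
  rw [D.cycle_length, dist_comm] at hj_zero
  unfold cycleDist
  omega

theorem dist_cycle_root_le {v : V} (hv : D.height v ≤ 1) :
    G.dist v (D.cycle (D.root v)) ≤ D.height v := by
  rcases Nat.le_one_iff_eq_zero_or_eq_one.1 hv with h0 | h1
  · rw [D.cycle_root v h0, dist_self]
    exact Nat.zero_le _
  · rw [h1, dist_eq_one_iff_adj.2 (D.adj_cycle_root h1)]

variable {D} in
theorem IsSun.dist_le (hS : D.IsSun) (u v : V) :
    G.dist u v ≤ D.height u + cycleDist k (D.root u) (D.root v) + D.height v := by
  have hu := D.dist_cycle_root_le (hS u)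
  have hv := D.dist_cycle_root_le (hS v)
  have huv := D.dist_cycle_le (D.root_lt u).le (D.root_lt v).le
  have := D.connected.dist_triangle (u := u) (v := D.cycle (D.root u)) (w := v)
  have := D.connected.dist_triangle (u := D.cycle (D.root u)) (v := D.cycle (D.root v)) (w := v)
  rw [dist_comm] at hv
  omega

section Finite

variable [Finite V]

theorem height_add_cycleDist_le_ecc (v : V) {i : ℕ} (hi : i ≤ k) :
    D.height v + cycleDist k (D.root v) i ≤ ecc G (D.cycle i) :=
  calc D.height v + cycleDist k (D.root v) i ≤ G.dist v (D.cycle i) :=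
        D.height_add_cycleDist_le_dist v hi
    _ = G.dist (D.cycle i) v := dist_comm
    _ ≤ ecc G (D.cycle i) := dist_le_ecc D.connected _ _

theorem height_add_half_le_ecc (v : V) : D.height v + k / 2 ≤ ecc G v := by
  have := D.root_lt v
  obtain ⟨j, hj, hanti⟩ : ∃ j ≤ k, cycleDist k (D.root v) j = k / 2 := by
    by_cases hlt : D.root v + k / 2 ≤ k
    · exact ⟨D.root v + k / 2, hlt, by unfold cycleDist; omega⟩
    · exact ⟨D.root v - k / 2, by omega, by unfold cycleDist; omega⟩
  rw [← hanti]
  exact (D.height_add_cycleDist_le_dist v hj).trans (dist_le_ecc D.connected _ _)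

variable {D}

theorem HasTreeAtZero.cycleEcc_le_ecc (h0 : D.HasTreeAtZero) {i : ℕ} (hi : i ≤ k) :
    cycleEcc k i ≤ ecc G (D.cycle i) := by
  obtain ⟨v, hv, hroot⟩ := h0
  have hfar := D.height_add_cycleDist_le_ecc v hi
  rw [hroot] at hfar
  exact max_le (le_of_add_le_right (D.height_add_half_le_ecc _)) (by omega)

theorem PendantsAtZero.ecc_cycle (hP : D.PendantsAtZero) (h0 : D.HasTreeAtZero) {i : ℕ}
    (hi : i ≤ k) : ecc G (D.cycle i) = cycleEcc k i := by
  refine le_antisymm ((ecc_le_iff D.connected).2 fun v => ?_) (h0.cycleEcc_le_ecc hi)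
  have hdist := hP.isSun.dist_le (D.cycle i) v
  have := D.root_cycle_of_le hi
  have := D.root_lt v
  have := hP v
  rw [D.height_cycle] at hdist
  unfold cycleDist at hdist
  unfold cycleEcc cycleDist
  omega

theorem PendantsAtZero.ecc_pendant (hP : D.PendantsAtZero) {u : V} (hu : D.height u ≠ 0) :
    ecc G u = k / 2 + 1 := by
  obtain ⟨hu1, hu0⟩ := hP u hu
  have hge := D.height_add_half_le_ecc u
  refine le_antisymm ((ecc_le_iff D.connected).2 fun v => ?_) (by omega)
  have hdist := hP.isSun.dist_le u v
  have := D.three_le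
  have := hP v
  rw [hu1, hu0] at hdist
  unfold cycleDist at hdist
  omega

end Finite

end CycleTreeDecomp

/-! ### The decomposition of a unicyclic graph -/

section Unicyclic

variable {V : Type*} {G : SimpleGraph V}

theorem IsUnicyclic.edgeSet_eq (hG : IsUnicyclic G) {x y : V} {p : G.Walk x x} {q : G.Walk y y}
    (hp : p.IsCycle) (hq : q.IsCycle) : q.edgeSet = p.edgeSet :=
  hG.2.unique ⟨y, q, hq, rfl⟩ ⟨x, p, hp, rfl⟩

theorem IsUnicyclic.isAcyclic_deleteEdges (hG : IsUnicyclic G) {x : V} {p : G.Walk x x}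
    (hp : p.IsCycle) {s : Set (Sym2 V)} {e : Sym2 V} (hes : e ∈ s) (hep : e ∈ p.edges) :
    (G.deleteEdges s).IsAcyclic := by
  intro y q hq
  have heq : e ∈ q.edges := by
    have : e ∈ (q.mapLe (deleteEdges_le s)).edgeSet := by
      rwa [hG.edgeSet_eq hp (hq.mapLe (deleteEdges_le s))]
    rwa [Walk.mem_edgeSet, Walk.edges_mapLe_eq_edges] at this
  have := q.edges_subset_edgeSet heq
  rw [edgeSet_deleteEdges] at this
  exact this.2 hes

theorem IsUnicyclic.card_edgeFinset [Fintype V] [Fintype G.edgeSet] (hG : IsUnicyclic G) :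
    G.edgeFinset.card = Fintype.card V := by
  classical
  obtain ⟨-, x, p, hp, -⟩ := hG.2.exists
  set e := s(x, p.snd)
  have hep : e ∈ p.edges := p.mk_start_snd_mem_edges hp.not_nil
  have heG : e ∈ G.edgeFinset := mem_edgeFinset.2 (p.edges_subset_edgeSet hep)
  have htree : (G.deleteEdges {e}).IsTree :=
    ⟨hG.1.connected_delete_edge_of_not_isBridge fun hb => hb.notMem_edges_of_isCycle hp hep,
      hG.isAcyclic_deleteEdges hp rfl hep⟩
  have herase : (G.deleteEdges {e}).edgeFinset = G.edgeFinset.erase e := by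
    ext e'
    simp [edgeSet_deleteEdges, and_comm]
  rw [← htree.card_edgeFinset, herase, Finset.card_erase_add_one heG]

theorem IsUnicyclic.isBridge (hG : IsUnicyclic G) {x u v : V} {p : G.Walk x x} (hp : p.IsCycle)
    (huv : G.Adj u v) (he : s(u, v) ∉ p.edges) : G.IsBridge s(u, v) :=
  (isBridge_iff_forall_cycle_notMem huv).2 fun _ _ hq hmem =>
    he (hG.edgeSet_eq hp hq ▸ hmem : s(u, v) ∈ p.edgeSet)

theorem exists_walk_edges_subset {x u v : V} (p : G.Walk x x) (hu : u ∈ p.support)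
    (hv : v ∈ p.support) : ∃ q : G.Walk u v, ∀ e ∈ q.edges, e ∈ p.edges := by
  classical
  refine ⟨(p.takeUntil u hu).reverse.append (p.takeUntil v hv), fun e he => ?_⟩
  rw [Walk.edges_append, List.mem_append, Walk.edges_reverse, List.mem_reverse] at he
  exact he.elim (p.edges_takeUntil_subset_edges hu ·) (p.edges_takeUntil_subset_edges hv ·)

-- The first edge of a path off the cycle is a bridge, but it could be bypassed along the cycle.
theorem IsUnicyclic.eq_of_reachable_deleteEdges (hG : IsUnicyclic G) {x u v : V}
    {p : G.Walk x x} (hp : p.IsCycle) (hu : u ∈ p.support) (hv : v ∈ p.support)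
    (h : (G.deleteEdges p.edgeSet).Reachable u v) : u = v := by
  classical
  obtain ⟨q, hq⟩ := h.exists_isPath
  cases q with
  | nil => rfl
  | @cons _ w _ huw q =>
    exfalso
    rw [deleteEdges_adj] at huw
    obtain ⟨t, ht⟩ := exists_walk_edges_subset p hu hv
    have hbypass := isBridge_iff_forall_walk_mem_edges.1 (hG.isBridge hp huw.1 huw.2)
      (t.append (q.mapLe (deleteEdges_le _)).reverse)
    rw [Walk.edges_append, List.mem_append, Walk.edges_reverse, List.mem_reverse,
      Walk.edges_mapLe_eq_edges] at hbypass
    rcases hbypass with he | he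
    · exact huw.2 (ht _ he)
    · exact ((Walk.cons_isPath_iff _ _).1 hq).2 (q.fst_mem_support_of_mem_edges he)

theorem exists_reachable_deleteEdges (hG : G.Connected) {x : V} (p : G.Walk x x) (v : V) :
    ∃ u ∈ p.support, (G.deleteEdges p.edgeSet).Reachable v u := by
  obtain ⟨q⟩ := hG.preconnected v x
  induction q with
  | nil => exact ⟨_, p.start_mem_support, .rfl⟩
  | @cons a b _ hab _ ih =>
    by_cases he : s(a, b) ∈ p.edges
    · exact ⟨a, p.fst_mem_support_of_mem_edges he, .rfl⟩
    · obtain ⟨u, hu, hbu⟩ := ih p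
      exact ⟨u, hu, (deleteEdges_adj.2 ⟨hab, he⟩).reachable.trans hbu⟩

theorem exists_adj_dist_eq_add_one {F : SimpleGraph V} {v z : V} (hr : F.Reachable v z)
    (hne : v ≠ z) : ∃ w, F.Adj v w ∧ F.Reachable w z ∧ F.dist v z = F.dist w z + 1 := by
  obtain ⟨q, hq⟩ := hr.exists_walk_length_eq_dist
  cases q with
  | nil => exact absurd rfl hne
  | @cons _ w _ hvw t =>
    refine ⟨w, hvw, t.reachable, le_antisymm ?_ ?_⟩
    · rw [add_comm, ← dist_eq_one_iff_adj.2 hvw]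
      exact hvw.reachable.dist_triangle_left z
    · rw [← hq, Walk.length_cons]
      exact Nat.succ_le_succ (dist_le t)

theorem exists_getVert_lt_length {x v : V} {p : G.Walk x x} (hp : ¬ p.Nil)
    (hv : v ∈ p.support) : ∃ i < p.length, p.getVert i = v := by
  obtain ⟨i, rfl, hi⟩ := Walk.mem_support_iff_exists_getVert.1 hv
  rcases hi.lt_or_eq with hi | rfl
  · exact ⟨i, hi, rfl⟩
  · exact ⟨0, Walk.not_nil_iff_lt_length.1 hp, by rw [Walk.getVert_zero, Walk.getVert_length]⟩

theorem IsUnicyclic.existsUnique_reachable_getVert (hG : IsUnicyclic G) {x : V}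
    {p : G.Walk x x} (hp : p.IsCycle) (v : V) :
    ∃! i, i < p.length ∧ (G.deleteEdges p.edgeSet).Reachable v (p.getVert i) := by
  obtain ⟨u, hu, hvu⟩ := exists_reachable_deleteEdges hG.1 p v
  obtain ⟨i, hi, rfl⟩ := exists_getVert_lt_length hp.not_nil hu
  refine ⟨i, ⟨hi, hvu⟩, fun j ⟨hj, hvj⟩ => hp.getVert_injOn' ?_ ?_ ?_⟩
  · exact Nat.le_sub_one_of_lt hj
  · exact Nat.le_sub_one_of_lt hi
  · exact hG.eq_of_reachable_deleteEdges hp (p.getVert_mem_support j) (p.getVert_mem_support i)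
      (hvj.symm.trans hvu)

theorem IsUnicyclic.exists_cycleTreeDecomp_of_isCycle (hG : IsUnicyclic G) {x : V}
    {p : G.Walk x x} (hp : p.IsCycle) :
    ∃ D : CycleTreeDecomp G p.length, D.cycle = p.getVert := by
  set F := G.deleteEdges p.edgeSet
  choose root hroot root_eq using hG.existsUnique_reachable_getVert hp
  have hroot_of_adj {u v : V} (huv : F.Adj u v) : root u = root v :=
    (root_eq u _ ⟨(hroot v).1, huv.reachable.trans (hroot v).2⟩).symm
  have hroot_cycle {i : ℕ} (hi : i < p.length) : root (p.getVert i) = i :=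
    (root_eq _ i ⟨hi, .rfl⟩).symm
  have hF : F.IsAcyclic := by
    have hmem := p.mk_start_snd_mem_edges hp.not_nil
    exact hG.isAcyclic_deleteEdges hp (e := s(x, p.snd)) hmem hmem
  refine ⟨{
    cycle := p.getVert
    root := root
    height v := F.dist (p.getVert (root v)) v
    three_le := hp.three_le_length
    cycle_length := by rw [Walk.getVert_length, Walk.getVert_zero]
    adj_cycle i hi := p.adj_getVert_succ hi
    root_lt v := (hroot v).1
    root_cycle i hi := hroot_cycle hi
    height_cycle i := ?_
    cycle_root v hv := (hroot v).2.symm.dist_eq_zero_iff.1 hv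
    adj_cases u v huv := ?_
    exists_parent v hv := ?_ }, rfl⟩
  · obtain ⟨j, hj, hij⟩ := exists_getVert_lt_length hp.not_nil (p.getVert_mem_support i)
    rw [← hij, hroot_cycle hj, dist_self]
  · by_cases he : s(u, v) ∈ p.edges
    · exact .inl ((p.mk_mem_edges_iff_exists.1 he).imp fun i => .imp_right Eq.symm)
    · have huvF : F.Adj u v := deleteEdges_adj.2 ⟨huv, he⟩
      refine .inr ⟨hroot_of_adj huvF, ?_⟩
      rw [hroot_of_adj huvF]
      exact hF.dist_eq_dist_add_one_of_adj_of_reachable _ huvF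
        ((hroot v).2.symm.trans huvF.symm.reachable)
  · obtain ⟨u, hvu, -, hdist⟩ := exists_adj_dist_eq_add_one (hroot v).2
      fun h => hv (by rw [← h, dist_self])
    refine ⟨u, (deleteEdges_adj.1 hvu).1, hroot_of_adj hvu, ?_⟩
    rw [← hroot_of_adj hvu, dist_comm, hdist, dist_comm]

theorem exists_notMem_support_of_length_lt_card [Fintype V] {x : V} {p : G.Walk x x}
    (hp : ¬ p.Nil) (hlt : p.length < Fintype.card V) : ∃ z, z ∉ p.support := by
  classical
  by_contra! hall
  have hcover : (Finset.univ : Finset V) ⊆ (Finset.range p.length).image p.getVert := by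
    intro v _
    obtain ⟨i, hi, hiv⟩ := exists_getVert_lt_length hp (hall v)
    exact Finset.mem_image.2 ⟨i, Finset.mem_range.2 hi, hiv⟩
  have := (Finset.card_le_card hcover).trans Finset.card_image_le
  rw [Finset.card_univ, Finset.card_range] at this
  omega

theorem IsUnicyclic.exists_cycleTreeDecomp [Fintype V] (hG : IsUnicyclic G) {k : ℕ}
    (hgirth : G.girth = k) (hk : k < Fintype.card V) :
    ∃ D : CycleTreeDecomp G k, D.HasTreeAtZero := by
  classical
  subst hgirth
  have hcyclic : ¬ G.IsAcyclic := fun h => by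
    obtain ⟨-, x, p, hp, -⟩ := hG.2.exists
    exact h p hp
  obtain ⟨x, p, hp, hlen⟩ := exists_girth_eq_length.2 hcyclic
  obtain ⟨z, hz⟩ := exists_notMem_support_of_length_lt_card hp.not_nil (hlen ▸ hk)
  obtain ⟨q⟩ := hG.1.preconnected x z
  obtain ⟨d, -, hfst, hsnd⟩ :=
    q.exists_boundary_dart {v | v ∈ p.support} p.start_mem_support hz
  have hfst : d.fst ∈ p.support := hfst
  obtain ⟨D, hD⟩ := hG.exists_cycleTreeDecomp_of_isCycle (hp.rotate hfst)
  have hoff (i : ℕ) : D.cycle i ≠ d.snd := by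
    rintro hi
    refine hsnd ((Walk.mem_support_rotate_iff _ _ hfst).1 ?_)
    rw [← hi, hD]
    exact Walk.getVert_mem_support _ _
  have hheight : D.height d.snd ≠ 0 := fun h => hoff _ (D.cycle_root _ h)
  have hroot : D.root d.snd = 0 := by
    rw [(D.adj_cases_of_height_ne_zero d.adj.symm hheight).1, ← D.root_cycle 0
      (by have := D.three_le; omega), hD, Walk.getVert_zero]
  rw [hlen, ← p.length_rotate _ hfst]
  exact ⟨D, d.snd, hheight, hroot⟩

end Unicyclic

/-! ### Edges of a cycle with attached trees -/

namespace CycleTreeDecomp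

variable {V : Type*} {G : SimpleGraph V} {k : ℕ} (D : CycleTreeDecomp G k)

open Classical in
/-- The edges of the cycle of a decomposition. -/
noncomputable def cycleEdges : Finset (Sym2 V) :=
  (Finset.range k).image fun i => s(D.cycle i, D.cycle (i + 1))

open Classical in
/-- The edges of the trees of a decomposition, that is, the edges off its cycle. -/
noncomputable def treeEdges [Fintype V] : Finset (Sym2 V) := G.edgeFinset \ D.cycleEdges

theorem injOn_cycleEdge :
    Set.InjOn (fun i => s(D.cycle i, D.cycle (i + 1))) (Finset.range k) := by
  intro i hi j hj hij
  have hi : i < k := Finset.mem_range.1 hi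
  have hj : j < k := Finset.mem_range.1 hj
  have h3 := D.three_le
  have hi₀ := D.root_cycle i hi
  have hj₀ := D.root_cycle j hj
  have hi₁ := D.root_cycle_of_le (i := i + 1) hi
  have hj₁ := D.root_cycle_of_le (i := j + 1) hj
  rcases Sym2.eq_iff.1 hij with ⟨e, -⟩ | ⟨e, e'⟩
  · rw [← hi₀, e, hj₀]
  · rw [e] at hi₀
    rw [e'] at hi₁
    omega

theorem sum_cycleEdges (g : Sym2 V → ℝ) :
    ∑ e ∈ D.cycleEdges, g e = ∑ i ∈ Finset.range k, g s(D.cycle i, D.cycle (i + 1)) := by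
  classical
  exact Finset.sum_image D.injOn_cycleEdge

theorem card_cycleEdges : D.cycleEdges.card = k := by
  classical
  rw [cycleEdges, Finset.card_image_of_injOn D.injOn_cycleEdge, Finset.card_range]

theorem cycleEdges_subset [Fintype G.edgeSet] : D.cycleEdges ⊆ G.edgeFinset := by
  classical
  intro e he
  obtain ⟨i, hi, rfl⟩ := Finset.mem_image.1 he
  exact mem_edgeFinset.2 (D.adj_cycle i (Finset.mem_range.1 hi))

variable [Fintype V]

theorem exists_of_mem_treeEdges {e : Sym2 V} (he : e ∈ D.treeEdges) :
    ∃ u v, e = s(u, v) ∧ G.Adj u v ∧ D.root u = D.root v ∧ D.height u = D.height v + 1 := by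
  classical
  obtain ⟨hadj, hcycle⟩ := Finset.mem_sdiff.1 he
  induction e with
  | h u v =>
    rw [mem_edgeFinset, mem_edgeSet] at hadj
    rcases D.adj_cases u v hadj with ⟨i, hi, hi'⟩ | ⟨hroot, hheight | hheight⟩
    · exact absurd (Finset.mem_image.2 ⟨i, Finset.mem_range.2 hi, hi'.symm⟩) hcycle
    · exact ⟨u, v, rfl, hadj, hroot, hheight⟩
    · exact ⟨v, u, Sym2.eq_swap, hadj.symm, hroot.symm, hheight⟩

theorem mk_mem_treeEdges {u v : V} (huv : G.Adj u v) (hu : D.height u ≠ 0) :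
    s(u, v) ∈ D.treeEdges := by
  classical
  refine Finset.mem_sdiff.2 ⟨mem_edgeFinset.2 huv, fun hmem => hu ?_⟩
  obtain ⟨i, -, he⟩ := Finset.mem_image.1 hmem
  rcases Sym2.eq_iff.1 he with ⟨rfl, -⟩ | ⟨-, rfl⟩ <;> exact D.height_cycle _

theorem card_treeEdges (hG : IsUnicyclic G) : D.treeEdges.card + k = Fintype.card V := by
  classical
  rw [← hG.card_edgeFinset, ← Finset.card_sdiff_add_card_eq_card D.cycleEdges_subset,
    D.card_cycleEdges, treeEdges]

theorem ABC3_eq_sum_add_sum :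
    ABC3 G = ∑ i ∈ Finset.range k, f (ecc G (D.cycle i)) (ecc G (D.cycle (i + 1))) +
      ∑ e ∈ D.treeEdges, edgeTerm G e := by
  classical
  rw [ABC3, ← Finset.sum_sdiff D.cycleEdges_subset, D.sum_cycleEdges, add_comm]
  rfl

end CycleTreeDecomp

/-! ### Girth at least four -/

/-- The value of `ABC3` on `H k (allAtFirst k (n - k))` for `4 ≤ k < n`. -/
noncomputable def extremalValue (n k : ℕ) : ℝ :=
  ∑ i ∈ Finset.range k, f (cycleEcc k i) (cycleEcc k (i + 1)) +
    ((n : ℝ) - k) * f (k / 2 + 1 : ℕ) (k / 2 : ℕ)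

theorem two_le_cycleEcc {k : ℕ} (hk : 4 ≤ k) (i : ℕ) : 2 ≤ cycleEcc k i :=
  le_max_of_le_left (by omega)

theorem exists_cycleEcc_lt {k j : ℕ} (hk : 4 ≤ k) (hj : 0 < j) (hjk : j < k)
    (hnear : cycleDist k 0 j < k / 2) :
    ∃ i < k, (cycleEcc k i < 1 + cycleDist k j i ∧ 3 ≤ cycleEcc k (i + 1)) ∨
      (cycleEcc k (i + 1) < 1 + cycleDist k j (i + 1) ∧ 3 ≤ cycleEcc k i) := by
  -- One end of the chosen edge is antipodal to `j`, the other lies towards the antipodes of `0`.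
  unfold cycleDist at hnear
  by_cases hhalf : j < k / 2
  · refine ⟨j + (k + 1) / 2 - 1, by omega, .inr ?_⟩
    unfold cycleEcc cycleDist
    omega
  · refine ⟨j - (k + 1) / 2, by omega, .inl ?_⟩
    unfold cycleEcc cycleDist
    omega

namespace CycleTreeDecomp

variable {V : Type*} {G : SimpleGraph V} {k : ℕ} {D : CycleTreeDecomp G k}

theorem HasTreeAtZero.f_ecc_cycle_le [Finite V] (h0 : D.HasTreeAtZero) (hk : 4 ≤ k) {i : ℕ}
    (hi : i < k) :
    f (ecc G (D.cycle i)) (ecc G (D.cycle (i + 1))) ≤ f (cycleEcc k i) (cycleEcc k (i + 1)) :=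
  f_le_f (mod_cast two_le_cycleEcc hk i) (mod_cast h0.cycleEcc_le_ecc hi.le)
    (mod_cast two_le_cycleEcc hk (i + 1)) (mod_cast h0.cycleEcc_le_ecc hi)

theorem HasTreeAtZero.f_ecc_cycle_lt [Finite V] (h0 : D.HasTreeAtZero) (hk : 4 ≤ k) {i : ℕ}
    (hi : i < k)
    (hlt : (cycleEcc k i < ecc G (D.cycle i) ∧ 3 ≤ cycleEcc k (i + 1)) ∨
      (cycleEcc k (i + 1) < ecc G (D.cycle (i + 1)) ∧ 3 ≤ cycleEcc k i)) :
    f (ecc G (D.cycle i)) (ecc G (D.cycle (i + 1))) < f (cycleEcc k i) (cycleEcc k (i + 1)) := by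
  have hi₂ : (2 : ℝ) ≤ cycleEcc k i := mod_cast two_le_cycleEcc hk i
  have hi₂' : (2 : ℝ) ≤ cycleEcc k (i + 1) := mod_cast two_le_cycleEcc hk (i + 1)
  have hle := h0.cycleEcc_le_ecc hi.le
  have hle' := h0.cycleEcc_le_ecc (i := i + 1) hi
  rcases hlt with ⟨hlt, h3⟩ | ⟨hlt, h3⟩
  · exact f_lt_f hi₂ (mod_cast hlt) hi₂' (mod_cast hle') (mod_cast h3.trans hle')
  · rw [f_comm, f_comm (cycleEcc k i : ℝ)]
    exact f_lt_f hi₂' (mod_cast hlt) hi₂ (mod_cast hle) (mod_cast h3.trans hle)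

theorem ecc_eq_half_of_edgeTerm_eq [Finite V] (hk : 4 ≤ k) {u v : V}
    (hheight : D.height u = D.height v + 1)
    (heq : edgeTerm G s(u, v) = f (k / 2 + 1 : ℕ) (k / 2 : ℕ)) : ecc G v = k / 2 := by
  have hu := D.height_add_half_le_ecc u
  have hv := D.height_add_half_le_ecc v
  by_contra hne
  have hlt : f (ecc G v) (ecc G u) < f (k / 2 : ℕ) (k / 2 + 1 : ℕ) :=
    f_lt_f (by norm_cast; omega) (by norm_cast; omega) (by norm_cast; omega)
      (by norm_cast; omega) (by norm_cast; omega)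
  rw [f_comm, f_comm (k / 2 : ℕ)] at hlt
  exact hlt.ne heq

variable [Fintype V]

theorem edgeTerm_le_of_mem_treeEdges (hk : 4 ≤ k) {e : Sym2 V} (he : e ∈ D.treeEdges) :
    edgeTerm G e ≤ f (k / 2 + 1 : ℕ) (k / 2 : ℕ) := by
  obtain ⟨u, v, rfl, -, -, hheight⟩ := D.exists_of_mem_treeEdges he
  have hu := D.height_add_half_le_ecc u
  have hv := D.height_add_half_le_ecc v
  rw [edgeTerm_mk]
  exact f_le_f (by norm_cast; omega) (by norm_cast; omega) (by norm_cast; omega)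
    (by norm_cast; omega)

theorem HasTreeAtZero.ABC3_le_extremalValue (h0 : D.HasTreeAtZero) (hG : IsUnicyclic G)
    (hk : 4 ≤ k) :
    ABC3 G ≤ extremalValue (Fintype.card V) k := by
  have hcard : (D.treeEdges.card : ℝ) + k = Fintype.card V := mod_cast D.card_treeEdges hG
  rw [D.ABC3_eq_sum_add_sum, extremalValue, ← hcard, add_sub_cancel_right, ← nsmul_eq_mul]
  exact add_le_add
    (Finset.sum_le_sum fun i hi => h0.f_ecc_cycle_le hk (Finset.mem_range.1 hi))
    (Finset.sum_le_card_nsmul _ _ _ fun e he => edgeTerm_le_of_mem_treeEdges hk he)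

theorem HasTreeAtZero.ABC3_eq_extremalValue_iff_edges (h0 : D.HasTreeAtZero)
    (hG : IsUnicyclic G) (hk : 4 ≤ k) :
    ABC3 G = extremalValue (Fintype.card V) k ↔
      (∀ i < k, f (ecc G (D.cycle i)) (ecc G (D.cycle (i + 1))) =
        f (cycleEcc k i) (cycleEcc k (i + 1))) ∧
      ∀ e ∈ D.treeEdges, edgeTerm G e = f (k / 2 + 1 : ℕ) (k / 2 : ℕ) := by
  have hcard : (D.treeEdges.card : ℝ) + k = Fintype.card V := mod_cast D.card_treeEdges hG
  have hcycle := fun i hi => h0.f_ecc_cycle_le hk (Finset.mem_range.1 hi) (i := i)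
  have htree := fun e he => edgeTerm_le_of_mem_treeEdges (D := D) hk he (e := e)
  rw [D.ABC3_eq_sum_add_sum, extremalValue, ← hcard, add_sub_cancel_right, ← nsmul_eq_mul,
    ← Finset.sum_const,
    add_eq_add_iff_eq_and_eq (Finset.sum_le_sum hcycle) (Finset.sum_le_sum htree),
    Finset.sum_eq_sum_iff_of_le hcycle, Finset.sum_eq_sum_iff_of_le htree]
  simp only [Finset.mem_range]

theorem height_eq_one_and_ecc_cycle_root_of_edgeTerm_eq (hk : 4 ≤ k)
    (htree : ∀ e ∈ D.treeEdges, edgeTerm G e = f (k / 2 + 1 : ℕ) (k / 2 : ℕ)) {w : V}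
    (hw : D.height w ≠ 0) : D.height w = 1 ∧ ecc G (D.cycle (D.root w)) = k / 2 := by
  obtain ⟨u, hwu, hroot, hheight⟩ := D.exists_parent w hw
  have hu := ecc_eq_half_of_edgeTerm_eq hk hheight (htree _ (D.mk_mem_treeEdges hwu hw))
  have hu0 : D.height u = 0 := by
    have := D.height_add_half_le_ecc u
    omega
  rw [hroot, D.cycle_root u hu0]
  exact ⟨by omega, hu⟩

theorem HasTreeAtZero.pendantsAtZero_of_edgeTerm_eq (h0 : D.HasTreeAtZero) (hk : 4 ≤ k)
    (hcycle : ∀ i < k, f (ecc G (D.cycle i)) (ecc G (D.cycle (i + 1))) =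
      f (cycleEcc k i) (cycleEcc k (i + 1)))
    (htree : ∀ e ∈ D.treeEdges, edgeTerm G e = f (k / 2 + 1 : ℕ) (k / 2 : ℕ)) :
    D.PendantsAtZero := by
  intro w hw
  have hw1 := (height_eq_one_and_ecc_cycle_root_of_edgeTerm_eq hk htree hw).1
  refine ⟨hw1, by_contra fun hroot => ?_⟩
  have hfar {i : ℕ} (hi : i ≤ k) : 1 + cycleDist k (D.root w) i ≤ ecc G (D.cycle i) :=
    hw1 ▸ D.height_add_cycleDist_le_ecc w hi
  have hecc0 : ecc G (D.cycle 0) = k / 2 := by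
    obtain ⟨v, hv, hv0⟩ := h0
    exact hv0 ▸ (height_eq_one_and_ecc_cycle_root_of_edgeTerm_eq hk htree hv).2
  have hnear : cycleDist k 0 (D.root w) < k / 2 := by
    have := hfar (Nat.zero_le k)
    unfold cycleDist at *
    omega
  obtain ⟨i, hi, hlt⟩ :=
    exists_cycleEcc_lt hk (Nat.pos_of_ne_zero hroot) (D.root_lt w) hnear
  exact (h0.f_ecc_cycle_lt hk hi (hlt.imp (.imp_left (·.trans_le (hfar hi.le)))
    (.imp_left (·.trans_le (hfar hi))))).ne (hcycle i hi)

theorem PendantsAtZero.edgeTerm_eq (hP : D.PendantsAtZero) (h0 : D.HasTreeAtZero) {e : Sym2 V}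
    (he : e ∈ D.treeEdges) : edgeTerm G e = f (k / 2 + 1 : ℕ) (k / 2 : ℕ) := by
  obtain ⟨u, v, rfl, -, hroot, hheight⟩ := D.exists_of_mem_treeEdges he
  obtain ⟨hu1, hu0⟩ := hP u (by omega)
  have hv : D.cycle 0 = v := by rw [← hu0, hroot, D.cycle_root v (by omega)]
  have hecc_v : ecc G v = k / 2 := by
    have := D.three_le
    rw [← hv, hP.ecc_cycle h0 (Nat.zero_le k)]
    unfold cycleEcc cycleDist
    omega
  rw [edgeTerm_mk, hP.ecc_pendant (by omega), hecc_v]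

theorem HasTreeAtZero.ABC3_eq_extremalValue_iff (h0 : D.HasTreeAtZero) (hG : IsUnicyclic G)
    (hk : 4 ≤ k) :
    ABC3 G = extremalValue (Fintype.card V) k ↔ D.PendantsAtZero := by
  rw [h0.ABC3_eq_extremalValue_iff_edges hG hk]
  refine ⟨fun ⟨hcycle, htree⟩ => h0.pendantsAtZero_of_edgeTerm_eq hk hcycle htree,
    fun hP => ⟨fun i hi => ?_, fun e he => hP.edgeTerm_eq h0 he⟩⟩
  rw [hP.ecc_cycle h0 hi.le, hP.ecc_cycle h0 hi]

end CycleTreeDecomp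

theorem extremalValue_of_even {n k : ℕ} (hk : 4 ≤ k) (heven : Even k) :
    extremalValue n k = ((n : ℝ) - k + 2) * f ((k : ℝ) / 2 + 1) ((k : ℝ) / 2) +
      ((k : ℝ) - 2) * f ((k : ℝ) / 2) ((k : ℝ) / 2) := by
  obtain ⟨b, rfl⟩ : ∃ b, k = (b + 2) + b := by
    obtain ⟨a, rfl⟩ := heven
    exact ⟨a - 1, by omega⟩
  have hecc (i : ℕ) : cycleEcc ((b + 2) + b) i = if i = b + 1 then b + 2 else b + 1 := by
    unfold cycleEcc cycleDist
    split_ifs <;> omega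
  have hbefore : ∀ i ∈ Finset.range b, f (cycleEcc ((b + 2) + b) i)
      (cycleEcc ((b + 2) + b) (i + 1)) = f (b + 1 : ℕ) (b + 1 : ℕ) := by
    intro i hi
    rw [Finset.mem_range] at hi
    rw [hecc, hecc, if_neg (by omega), if_neg (by omega)]
  have hafter : ∀ i ∈ Finset.range b, f (cycleEcc ((b + 2) + b) (b + 2 + i))
      (cycleEcc ((b + 2) + b) (b + 2 + i + 1)) = f (b + 1 : ℕ) (b + 1 : ℕ) := by
    intro i _
    rw [hecc, hecc, if_neg (by omega), if_neg (by omega)]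
  have hhalf : ((b + 2 + b : ℕ) : ℝ) / 2 = (b + 1 : ℕ) := by push_cast; ring
  rw [extremalValue, Finset.sum_range_add, Finset.sum_range_succ, Finset.sum_range_succ,
    Finset.sum_eq_card_nsmul hbefore, Finset.sum_eq_card_nsmul hafter, hecc, hecc, hecc,
    if_neg (by omega), if_pos rfl, if_neg (by omega), f_comm (b + 1 : ℕ) (b + 2 : ℕ), hhalf,
    show (b + 2 + b) / 2 = b + 1 by omega]
  simp only [Finset.card_range, nsmul_eq_mul]
  push_cast
  ring_nf

theorem extremalValue_of_odd {n k : ℕ} (hk : 4 ≤ k) (hodd : Odd k) :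
    extremalValue n k = ((n : ℝ) - k + 2) * f (((k : ℝ) + 1) / 2) (((k : ℝ) - 1) / 2) +
      ((k : ℝ) - 3) * f (((k : ℝ) - 1) / 2) (((k : ℝ) - 1) / 2) +
      f (((k : ℝ) + 1) / 2) (((k : ℝ) + 1) / 2) := by
  obtain ⟨b, rfl⟩ : ∃ b, k = (b + 3) + b := by
    obtain ⟨a, rfl⟩ := hodd
    exact ⟨a - 1, by omega⟩
  have hecc (i : ℕ) : cycleEcc ((b + 3) + b) i =
      if i = b + 1 ∨ i = b + 2 then b + 2 else b + 1 := by
    unfold cycleEcc cycleDist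
    split_ifs <;> omega
  have hbefore : ∀ i ∈ Finset.range b, f (cycleEcc ((b + 3) + b) i)
      (cycleEcc ((b + 3) + b) (i + 1)) = f (b + 1 : ℕ) (b + 1 : ℕ) := by
    intro i hi
    rw [Finset.mem_range] at hi
    rw [hecc, hecc, if_neg (by omega), if_neg (by omega)]
  have hafter : ∀ i ∈ Finset.range b, f (cycleEcc ((b + 3) + b) (b + 3 + i))
      (cycleEcc ((b + 3) + b) (b + 3 + i + 1)) = f (b + 1 : ℕ) (b + 1 : ℕ) := by
    intro i _
    rw [hecc, hecc, if_neg (by omega), if_neg (by omega)]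
  have hfloor : (((b + 3 + b : ℕ) : ℝ) - 1) / 2 = (b + 1 : ℕ) := by push_cast; ring
  have hceil : (((b + 3 + b : ℕ) : ℝ) + 1) / 2 = (b + 2 : ℕ) := by push_cast; ring
  rw [extremalValue, Finset.sum_range_add, Finset.sum_range_succ, Finset.sum_range_succ,
    Finset.sum_range_succ, Finset.sum_eq_card_nsmul hbefore, Finset.sum_eq_card_nsmul hafter,
    hecc, hecc, hecc, hecc, if_neg (by omega), if_pos (by omega), if_pos (by omega),
    if_neg (by omega), f_comm (b + 1 : ℕ) (b + 2 : ℕ), hfloor, hceil,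
    show (b + 3 + b) / 2 = b + 1 by omega]
  simp only [Finset.card_range, nsmul_eq_mul]
  push_cast
  ring_nf

/-! ### Girth three -/

namespace CycleTreeDecomp

section Triangle

variable {V : Type*} {G : SimpleGraph V} {D : CycleTreeDecomp G 3}

theorem HasTreeAtZero.three_le_ecc_add_ecc [Finite V] (h0 : D.HasTreeAtZero) {u w : V}
    (huw : G.Adj u w) : 3 ≤ ecc G u + ecc G w := by
  rcases D.adj_cases u w huw with ⟨i, hi, he⟩ | ⟨-, hheight⟩
  · have hfst := h0.cycleEcc_le_ecc hi.le
    have hsnd := h0.cycleEcc_le_ecc (i := i + 1) hi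
    unfold cycleEcc cycleDist at hfst hsnd
    rcases Sym2.eq_iff.1 he with ⟨rfl, rfl⟩ | ⟨rfl, rfl⟩ <;> omega
  · have := D.height_add_half_le_ecc u
    have := D.height_add_half_le_ecc w
    omega

theorem HasTreeAtZero.edgeTerm_le_sqrt_half [Finite V] (h0 : D.HasTreeAtZero) {e : Sym2 V}
    (he : e ∈ G.edgeSet) : edgeTerm G e ≤ √(1 / 2) := by
  induction e with
  | h u w =>
    exact f_le_sqrt_half (ecc_le_succ_of_adj D.connected he)
      (ecc_le_succ_of_adj D.connected he.symm) (h0.three_le_ecc_add_ecc he)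

theorem HasTreeAtZero.edgeTerm_eq_sqrt_half_iff [Finite V] (h0 : D.HasTreeAtZero) {u w : V}
    (huw : G.Adj u w) : edgeTerm G s(u, w) = √(1 / 2) ↔ ecc G u ≤ 2 ∨ ecc G w ≤ 2 :=
  f_eq_sqrt_half_iff (ecc_le_succ_of_adj D.connected huw)
    (ecc_le_succ_of_adj D.connected huw.symm) (h0.three_le_ecc_add_ecc huw)

theorem isSun_of_forall_ecc_le_two [Finite V]
    (h : ∀ u w, G.Adj u w → ecc G u ≤ 2 ∨ ecc G w ≤ 2) : D.IsSun := by
  intro v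
  by_contra! hv
  have hroot := D.root_lt v
  obtain ⟨i, hi, hdist, hdist'⟩ :
      ∃ i < 3, cycleDist 3 (D.root v) i = 1 ∧ cycleDist 3 (D.root v) (i + 1) = 1 := by
    generalize D.root v = r at hroot
    decide +revert
  have := D.height_add_cycleDist_le_ecc v hi.le
  have := D.height_add_cycleDist_le_ecc v (i := i + 1) hi
  have := h _ _ (D.adj_cycle i hi)
  omega

theorem IsSun.ecc_le_two [Finite V] (hS : D.IsSun) {u : V} (hu : D.height u = 0) :
    ecc G u ≤ 2 := by
  refine (ecc_le_iff D.connected).2 fun v => ?_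
  have hdist := hS.dist_le u v
  have := D.root_lt u
  have := D.root_lt v
  have := hS v
  unfold cycleDist at hdist
  omega

theorem isSun_iff_forall_ecc_le_two [Finite V] :
    D.IsSun ↔ ∀ u w, G.Adj u w → ecc G u ≤ 2 ∨ ecc G w ≤ 2 :=
  ⟨fun hS _ _ huw => (hS.height_eq_zero_of_adj huw).imp hS.ecc_le_two hS.ecc_le_two,
    isSun_of_forall_ecc_le_two⟩

variable [Fintype V]

theorem HasTreeAtZero.ABC3_triangle_le (h0 : D.HasTreeAtZero) (hG : IsUnicyclic G) :
    ABC3 G ≤ Fintype.card V * √(1 / 2) := by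
  classical
  rw [← hG.card_edgeFinset, ← nsmul_eq_mul]
  exact Finset.sum_le_card_nsmul _ _ _ fun _ he => h0.edgeTerm_le_sqrt_half (mem_edgeFinset.1 he)

theorem HasTreeAtZero.ABC3_triangle_eq_iff (h0 : D.HasTreeAtZero) (hG : IsUnicyclic G) :
    ABC3 G = Fintype.card V * √(1 / 2) ↔ D.IsSun := by
  classical
  rw [← hG.card_edgeFinset, ← nsmul_eq_mul, ← Finset.sum_const, ABC3,
    Finset.sum_eq_sum_iff_of_le fun _ he => h0.edgeTerm_le_sqrt_half (mem_edgeFinset.1 he),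
    isSun_iff_forall_ecc_le_two, Sym2.forall]
  refine forall₂_congr fun u w => ?_
  rw [mem_edgeFinset, mem_edgeSet]
  exact forall_congr' h0.edgeTerm_eq_sqrt_half_iff

end Triangle

end CycleTreeDecomp

/-! ### Recognizing the graphs `H k m` -/

theorem cycleGraph_adj_iff_val {k : ℕ} (hk : 3 ≤ k) (i j : Fin k) :
    (cycleGraph k).Adj i j ↔ (i : ℕ) + 1 = j ∨ (j : ℕ) + 1 = i ∨
      ((i : ℕ) = 0 ∧ (j : ℕ) + 1 = k) ∨ ((j : ℕ) = 0 ∧ (i : ℕ) + 1 = k) := by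
  have hsub (a b : Fin k) :
      (a - b).val = 1 ↔ (b : ℕ) + 1 = a ∨ ((a : ℕ) = 0 ∧ (b : ℕ) + 1 = k) := by
    rcases le_or_gt b a with h | h
    · rw [Fin.coe_sub_iff_le.2 h]
      omega
    · rw [Fin.coe_sub_iff_lt.2 h]
      omega
  rw [cycleGraph_adj', hsub, hsub]
  tauto

theorem H_adj_inr_iff {k : ℕ} {m : Fin k → ℕ} {x : Σ i : Fin k, Fin (m i)}
    {b : Fin k ⊕ Σ i : Fin k, Fin (m i)} : (H k m).Adj (.inr x) b ↔ b = .inl x.1 := by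
  rcases b with i | y
  · exact eq_comm.trans Sum.inl_injective.eq_iff.symm
  · exact iff_of_false id Sum.inr_ne_inl

namespace CycleTreeDecomp

variable {V : Type*} {G : SimpleGraph V} {k : ℕ} (D : CycleTreeDecomp G k)

theorem adj_cycle_iff (i j : Fin k) :
    G.Adj (D.cycle i) (D.cycle j) ↔ (cycleGraph k).Adj i j := by
  rw [cycleGraph_adj_iff_val D.three_le]
  constructor
  · intro hadj
    have hi := D.root_cycle i i.2
    have hj := D.root_cycle j j.2
    rcases D.adj_cases _ _ hadj with ⟨l, hl, he⟩ | ⟨-, hheight⟩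
    · have hl₀ := D.root_cycle l hl
      have hl₁ := D.root_cycle_of_le (i := l + 1) hl
      rcases Sym2.eq_iff.1 he with ⟨e, e'⟩ | ⟨e, e'⟩ <;>
        · rw [e] at hi
          rw [e'] at hj
          omega
    · simp only [D.height_cycle] at hheight
      omega
  · have hi := D.adj_cycle i i.2
    have hj := D.adj_cycle j j.2
    rintro (hij | hij | ⟨h0, hk⟩ | ⟨h0, hk⟩)
    · rwa [hij] at hi
    · rwa [hij, G.adj_comm] at hj
    · rwa [hk, D.cycle_length, ← h0, G.adj_comm] at hj
    · rwa [hk, D.cycle_length, ← h0] at hi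

/-- The number of vertices at height one in the tree attached to `cycle i`. -/
noncomputable def pendantCount (i : ℕ) : ℕ := Nat.card {v // D.height v = 1 ∧ D.root v = i}

section Sun

variable [Finite V]

/-- The parametrization of a sun by the vertices of `H k m`, where `m i` is the number of pendant
vertices attached to `cycle i`. -/
noncomputable def sunMap : (Fin k ⊕ Σ i : Fin k, Fin (D.pendantCount i)) → V :=
  Sum.elim (fun i => D.cycle i) fun x =>
    ((Finite.equivFin {v // D.height v = 1 ∧ D.root v = x.1}).symm x.2).1

theorem height_sunMap_inl (i : Fin k) : D.height (D.sunMap (.inl i)) = 0 := D.height_cycle i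

theorem root_sunMap_inl (i : Fin k) : D.root (D.sunMap (.inl i)) = i := D.root_cycle i i.2

theorem height_sunMap_inr (x : Σ i : Fin k, Fin (D.pendantCount i)) :
    D.height (D.sunMap (.inr x)) = 1 :=
  ((Finite.equivFin _).symm x.2).2.1

theorem root_sunMap_inr (x : Σ i : Fin k, Fin (D.pendantCount i)) :
    D.root (D.sunMap (.inr x)) = x.1 :=
  ((Finite.equivFin _).symm x.2).2.2

theorem sunMap_injective : Function.Injective D.sunMap := by
  rintro (i | ⟨i, x⟩) (j | ⟨j, y⟩) hij
  · have hroot := congrArg D.root hij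
    rw [root_sunMap_inl, root_sunMap_inl] at hroot
    rw [Fin.ext hroot]
  · have hheight := congrArg D.height hij
    rw [height_sunMap_inl, height_sunMap_inr] at hheight
    exact absurd hheight zero_ne_one
  · have hheight := congrArg D.height hij
    rw [height_sunMap_inl, height_sunMap_inr] at hheight
    exact absurd hheight one_ne_zero
  · have hroot := congrArg D.root hij
    rw [root_sunMap_inr, root_sunMap_inr] at hroot
    obtain rfl : i = j := Fin.ext hroot
    have hxy : x = y := (Finite.equivFin _).symm.injective (Subtype.ext hij)
    rw [hxy]

variable {D} in
theorem IsSun.sunMap_surjective (hS : D.IsSun) : Function.Surjective D.sunMap := by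
  intro v
  rcases Nat.le_one_iff_eq_zero_or_eq_one.1 (hS v) with h0 | h1
  · exact ⟨.inl ⟨D.root v, D.root_lt v⟩, D.cycle_root v h0⟩
  · refine ⟨.inr ⟨⟨D.root v, D.root_lt v⟩, Finite.equivFin _ ⟨v, h1, rfl⟩⟩, ?_⟩
    exact congrArg Subtype.val (Equiv.symm_apply_apply _ _)

theorem adj_sunMap_inr_iff (x : Σ i : Fin k, Fin (D.pendantCount i))
    (b : Fin k ⊕ Σ i : Fin k, Fin (D.pendantCount i)) :
    G.Adj (D.sunMap (.inr x)) (D.sunMap b) ↔ b = .inl x.1 := by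
  have hx := D.height_sunMap_inr x
  constructor
  · intro hadj
    have hroot := D.adj_cases_of_height_ne_zero hadj (by omega)
    rw [D.root_sunMap_inr, hx] at hroot
    rcases b with i | y
    · rw [D.root_sunMap_inl] at hroot
      rw [Fin.ext hroot.1]
    · rw [D.height_sunMap_inr] at hroot
      omega
  · rintro rfl
    have hadj := D.adj_cycle_root hx
    rwa [D.root_sunMap_inr] at hadj

theorem adj_sunMap_iff (a b : Fin k ⊕ Σ i : Fin k, Fin (D.pendantCount i)) :
    G.Adj (D.sunMap a) (D.sunMap b) ↔ (H k fun i => D.pendantCount i).Adj a b := by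
  rcases a with i | x
  · rcases b with j | y
    · exact D.adj_cycle_iff i j
    · rw [G.adj_comm, D.adj_sunMap_inr_iff, adj_comm, H_adj_inr_iff]
  · rw [D.adj_sunMap_inr_iff, H_adj_inr_iff]

variable {D} in
/-- A sun of cycle length `k` is isomorphic to `H k m`, where `m i` is the number of pendant
vertices attached to `cycle i`. -/
noncomputable def IsSun.iso (hS : D.IsSun) : H k (fun i => D.pendantCount i) ≃g G where
  toEquiv := Equiv.ofBijective D.sunMap ⟨D.sunMap_injective, hS.sunMap_surjective⟩
  map_rel_iff' := D.adj_sunMap_iff _ _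

end Sun

variable {D} in
theorem IsSun.card_eq [Fintype V] (hS : D.IsSun) :
    k + ∑ i : Fin k, D.pendantCount i = Fintype.card V := by
  rw [← Fintype.card_congr hS.iso.toEquiv, Fintype.card_sum, Fintype.card_sigma, Fintype.card_fin]
  simp only [Fintype.card_fin]

variable {D} in
theorem PendantsAtZero.pendantCount_eq [Fintype V] (hP : D.PendantsAtZero) :
    (fun i : Fin k => D.pendantCount i) = allAtFirst k (Fintype.card V - k) := by
  have hk := D.three_le
  have hzero (i : Fin k) (hi : (i : ℕ) ≠ 0) : D.pendantCount i = 0 := by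
    have : IsEmpty {v // D.height v = 1 ∧ D.root v = i} :=
      ⟨fun v => hi (by rw [← v.2.2, (hP v (by rw [v.2.1]; exact one_ne_zero)).2])⟩
    exact Nat.card_of_isEmpty
  have hsum : ∑ i : Fin k, D.pendantCount i = D.pendantCount 0 :=
    Fintype.sum_eq_single (⟨0, by omega⟩ : Fin k) fun i hi => hzero i fun h0 => hi (Fin.ext h0)
  have hcard := hP.isSun.card_eq
  funext i
  unfold allAtFirst
  split_ifs with hi
  · rw [hi]
    omega
  · exact hzero i hi

section Iso

variable {m : Fin k → ℕ}

theorem exists_two_adj_cycle {i : ℕ} (hi : i < k) :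
    ∃ u w, u ≠ w ∧ G.Adj (D.cycle i) u ∧ G.Adj (D.cycle i) w := by
  have hk := D.three_le
  have hnext := D.root_cycle_of_le (i := i + 1) hi
  rcases Nat.eq_zero_or_pos i with rfl | hpos
  · have hlast := D.adj_cycle (k - 1) (by omega)
    rw [Nat.sub_add_cancel (by omega), D.cycle_length] at hlast
    refine ⟨_, _, fun h => ?_, D.adj_cycle 0 hi, hlast.symm⟩
    rw [h, D.root_cycle _ (by omega)] at hnext
    omega
  · have hprev := D.adj_cycle (i - 1) (by omega)
    rw [Nat.sub_add_cancel hpos] at hprev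
    refine ⟨_, _, fun h => ?_, D.adj_cycle i hi, hprev.symm⟩
    rw [h, D.root_cycle _ (by omega)] at hnext
    omega

theorem exists_iso_cycle_eq_inl (φ : G ≃g H k m) {i : ℕ} (hi : i < k) :
    ∃ a, φ (D.cycle i) = .inl a := by
  obtain ⟨u, w, huw, hu, hw⟩ := D.exists_two_adj_cycle hi
  rcases hx : φ (D.cycle i) with a | x
  · exact ⟨a, rfl⟩
  · rw [← φ.map_adj_iff, hx, H_adj_inr_iff] at hu hw
    exact absurd (φ.injective (hu.trans hw.symm)) huw

theorem exists_cycle_eq_of_iso (φ : G ≃g H k m) (a : Fin k) :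
    ∃ i < k, φ (D.cycle i) = .inl a := by
  choose g hg using fun i : Fin k => D.exists_iso_cycle_eq_inl φ i.2
  have hinj : Function.Injective g := by
    intro i j hij
    have hcycle : D.cycle i = D.cycle j := φ.injective (by rw [hg, hg, hij])
    rw [Fin.ext_iff, ← D.root_cycle i i.2, hcycle, D.root_cycle j j.2]
  obtain ⟨i, rfl⟩ := Finite.surjective_of_injective hinj a
  exact ⟨i, i.2, hg i⟩

theorem height_eq_one_and_iso_eq_inr (φ : G ≃g H k m) {v : V} (hv : D.height v ≠ 0) :
    D.height v = 1 ∧ ∃ x, φ v = .inr x ∧ φ (D.cycle (D.root v)) = .inl x.1 := by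
  rcases hx : φ v with a | x
  · obtain ⟨i, -, hi⟩ := D.exists_cycle_eq_of_iso φ a
    rw [← φ.injective (hi.trans hx.symm), D.height_cycle] at hv
    exact absurd rfl hv
  · obtain ⟨i, hik, hi⟩ := D.exists_cycle_eq_of_iso φ x.1
    have hadj : G.Adj v (D.cycle i) := by
      rw [← φ.map_adj_iff, hx, hi, H_adj_inr_iff]
    have hcases := D.adj_cases_of_height_ne_zero hadj hv
    rw [D.root_cycle i hik, D.height_cycle] at hcases
    exact ⟨by omega, x, rfl, by rw [hcases.1, hi]⟩

theorem isSun_of_iso (φ : G ≃g H k m) : D.IsSun := fun v => by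
  by_contra hv
  exact hv (D.height_eq_one_and_iso_eq_inr φ (by omega)).1.le

variable {D} in
theorem HasTreeAtZero.pendantsAtZero_of_iso (h0 : D.HasTreeAtZero) {a : ℕ}
    (φ : G ≃g H k (allAtFirst k a)) : D.PendantsAtZero := by
  have hzero (x : Σ i : Fin k, Fin (allAtFirst k a i)) : (x.1 : ℕ) = 0 := by
    by_contra hi
    have := x.2.2
    simp only [allAtFirst, if_neg hi, not_lt_zero] at this
  obtain ⟨v, hv, hroot⟩ := h0
  obtain ⟨-, x, -, hx⟩ := D.height_eq_one_and_iso_eq_inr φ hv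
  intro w hw
  obtain ⟨hw1, y, -, hy⟩ := D.height_eq_one_and_iso_eq_inr φ hw
  rw [Fin.ext ((hzero x).trans (hzero y).symm), ← hy, φ.injective.eq_iff, hroot] at hx
  rw [← D.root_cycle _ (D.root_lt w), ← hx, D.root_cycle 0 (by have := D.three_le; omega)]
  exact ⟨hw1, rfl⟩

end Iso

theorem isSun_iff [Fintype V] :
    D.IsSun ↔ ∃ m : Fin k → ℕ, k + ∑ i, m i = Fintype.card V ∧ Nonempty (G ≃g H k m) :=
  ⟨fun hS => ⟨_, hS.card_eq, ⟨hS.iso.symm⟩⟩, fun ⟨_, _, ⟨φ⟩⟩ => D.isSun_of_iso φ⟩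

variable {D} in
theorem HasTreeAtZero.pendantsAtZero_iff [Fintype V] (h0 : D.HasTreeAtZero) :
    D.PendantsAtZero ↔ Nonempty (G ≃g H k (allAtFirst k (Fintype.card V - k))) :=
  ⟨fun hP => hP.pendantCount_eq ▸ ⟨hP.isSun.iso.symm⟩, fun ⟨φ⟩ => h0.pendantsAtZero_of_iso φ⟩

end CycleTreeDecomp

end ABCThree

theorem lemma2p5_general {V : Type*} [Fintype V] (G : SimpleGraph V) (n k : ℕ)
    (hG : ABCThree.IsUnicyclic G) (hcard : Fintype.card V = n) (hgirth : G.girth = k)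
    (hkn : k < n) :
    (k = 3 →
      ABCThree.ABC3 G ≤ (n : ℝ) * Real.sqrt (1 / 2) ∧
      (ABCThree.ABC3 G = (n : ℝ) * Real.sqrt (1 / 2) ↔
        ∃ m : Fin 3 → ℕ, 3 + ∑ i, m i = n ∧ Nonempty (G ≃g ABCThree.H 3 m))) ∧
    (4 ≤ k → Even k →
      ABCThree.ABC3 G ≤
        ((n : ℝ) - k + 2) * ABCThree.f ((k : ℝ) / 2 + 1) ((k : ℝ) / 2) +
          ((k : ℝ) - 2) * ABCThree.f ((k : ℝ) / 2) ((k : ℝ) / 2) ∧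
      (ABCThree.ABC3 G =
        ((n : ℝ) - k + 2) * ABCThree.f ((k : ℝ) / 2 + 1) ((k : ℝ) / 2) +
          ((k : ℝ) - 2) * ABCThree.f ((k : ℝ) / 2) ((k : ℝ) / 2) ↔
        Nonempty (G ≃g ABCThree.H k (ABCThree.allAtFirst k (n - k))))) ∧
    (4 ≤ k → Odd k →
      ABCThree.ABC3 G ≤
        ((n : ℝ) - k + 2) * ABCThree.f (((k : ℝ) + 1) / 2) (((k : ℝ) - 1) / 2) +
          ((k : ℝ) - 3) * ABCThree.f (((k : ℝ) - 1) / 2) (((k : ℝ) - 1) / 2) +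
          ABCThree.f (((k : ℝ) + 1) / 2) (((k : ℝ) + 1) / 2) ∧
      (ABCThree.ABC3 G =
        ((n : ℝ) - k + 2) * ABCThree.f (((k : ℝ) + 1) / 2) (((k : ℝ) - 1) / 2) +
          ((k : ℝ) - 3) * ABCThree.f (((k : ℝ) - 1) / 2) (((k : ℝ) - 1) / 2) +
          ABCThree.f (((k : ℝ) + 1) / 2) (((k : ℝ) + 1) / 2) ↔
        Nonempty (G ≃g ABCThree.H k (ABCThree.allAtFirst k (n - k))))) := by
  subst hcard
  obtain ⟨D, h0⟩ := hG.exists_cycleTreeDecomp hgirth hkn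
  refine ⟨?_, fun hk heven => ?_, fun hk hodd => ?_⟩
  · rintro rfl
    exact ⟨h0.ABC3_triangle_le hG, (h0.ABC3_triangle_eq_iff hG).trans D.isSun_iff⟩
  · rw [← ABCThree.extremalValue_of_even hk heven]
    exact ⟨h0.ABC3_le_extremalValue hG hk,
      (h0.ABC3_eq_extremalValue_iff hG hk).trans h0.pendantsAtZero_iff⟩
  · rw [← ABCThree.extremalValue_of_odd hk hodd]
    exact ⟨h0.ABC3_le_extremalValue hG hk,
      (h0.ABC3_eq_extremalValue_iff hG hk).trans h0.pendantsAtZero_iff⟩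

theorem lemma2p5 {V : Type*} [Fintype V] (G : SimpleGraph V) (n k : ℕ)
    (hG : ABCThree.IsUnicyclic G) (hcard : Fintype.card V = n) (hgirth : G.girth = k)
    (hn : 6 ≤ n) (hkn : k < n) :
    (k = 3 →
      ABCThree.ABC3 G ≤ (n : ℝ) * Real.sqrt (1 / 2) ∧
      (ABCThree.ABC3 G = (n : ℝ) * Real.sqrt (1 / 2) ↔
        ∃ m : Fin 3 → ℕ, 3 + ∑ i, m i = n ∧ Nonempty (G ≃g ABCThree.H 3 m))) ∧
    (4 ≤ k → Even k →
      ABCThree.ABC3 G ≤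
        ((n : ℝ) - k + 2) * ABCThree.f ((k : ℝ) / 2 + 1) ((k : ℝ) / 2) +
          ((k : ℝ) - 2) * ABCThree.f ((k : ℝ) / 2) ((k : ℝ) / 2) ∧
      (ABCThree.ABC3 G =
        ((n : ℝ) - k + 2) * ABCThree.f ((k : ℝ) / 2 + 1) ((k : ℝ) / 2) +
          ((k : ℝ) - 2) * ABCThree.f ((k : ℝ) / 2) ((k : ℝ) / 2) ↔
        Nonempty (G ≃g ABCThree.H k (ABCThree.allAtFirst k (n - k))))) ∧
    (4 ≤ k → Odd k →
      ABCThree.ABC3 G ≤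
        ((n : ℝ) - k + 2) * ABCThree.f (((k : ℝ) + 1) / 2) (((k : ℝ) - 1) / 2) +
          ((k : ℝ) - 3) * ABCThree.f (((k : ℝ) - 1) / 2) (((k : ℝ) - 1) / 2) +
          ABCThree.f (((k : ℝ) + 1) / 2) (((k : ℝ) + 1) / 2) ∧
      (ABCThree.ABC3 G =
        ((n : ℝ) - k + 2) * ABCThree.f (((k : ℝ) + 1) / 2) (((k : ℝ) - 1) / 2) +
          ((k : ℝ) - 3) * ABCThree.f (((k : ℝ) - 1) / 2) (((k : ℝ) - 1) / 2) +
          ABCThree.f (((k : ℝ) + 1) / 2) (((k : ℝ) + 1) / 2) ↔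
        Nonempty (G ≃g ABCThree.H k (ABCThree.allAtFirst k (n - k))))) :=
  lemma2p5_general G n k hG hcard hgirth hkn
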